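/- Let $\mathbb{D}=\{z\in\mathbb{C}:|z|<1\}$, and let $\mathcal{A}$ be the class of analytic functions $f$ on $\mathbb{D}$ with $f(0)=0$ and $f'(0)=1$. Let $S^*(1/2)$ be the class of $g\in\mathcal{A}$ with $\operatorname{Re}\bigl(zg'(z)/g(z)\bigr)>1/2$ on $\mathbb{D}$. For functions $p,q$ on $\mathbb{D}$ write $p\prec q$ if there is an analytic $w:\mathbb{D}\to\mathbb{D}$ with $w(0)=0$ and $p=q\circ w$ on $\mathbb{D}$. For $\varphi$ analytic on $\mathbb{D}$ with positive real part, let $\mathcal{K}_s(\varphi)$ be the class of all $f\in\mathcal{A}$ such that \[ -\frac{z^2f'(z)}{g(z)g(-z)}\prec\varphi(z)\quad\text{for some } g\in S^*(1/2), \] where quotients with a removable singularity at $z=0$ take their limit value $1$ there. **Theorem.** Let $\varphi$ be an analytic univalent function on $\mathbb{D}$ with positive real part and $\varphi(0)=1$, such that for every $0\le r<1$ \[ \varphi(-r)=\min_{|z|=r}|\varphi(z)|,\qquad \varphi(r)=\max_{|z|=r}|\varphi(z)| \] (in particular, these two values are real). Then for every $f\in\mathcal{K}_s(\varphi)$ and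 every $z$ with $|z|=r<1$, \[ \frac{\varphi(-r)}{1+r^2}\le|f'(z)|\le\frac{\varphi(r)}{1-r^2},\qquad \int_0^r\frac{\varphi(-t)}{1+t^2}\,dt\le|f(z)|\le\int_0^r\frac{\varphi(t)}{1-t^2}\,dt. \] All four inequalities are sharp: the functions \[ f_0(z)=\int_0^z\frac{\varphi(w)}{1-w^2}\,dw,\qquad f_1(z)=\int_0^z\frac{\varphi(w)}{1+w^2}\,dw \] belong to $\mathcal{K}_s(\varphi)$, and for every $0\le r<1$ equality holds in both upper bounds for $f=f_0$ at $z=r$, and in both lower bounds for $f=f_1$ at $z=-r$. -/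

import Mathlib

open Metric

namespace CloseToConvex

/-- The class `𝒜`: holomorphic on the open unit disk with `f 0 = 0` and `f' 0 = 1`. -/
structure Normalized (f : ℂ → ℂ) : Prop where
  differentiableOn : DifferentiableOn ℂ f (ball 0 1)
  map_zero : f 0 = 0
  deriv_zero : deriv f 0 = 1

/-- The class `S*(α)` of starlike functions of order `α`: normalized functions with
`Re (z g'(z) / g(z)) > α` in the unit disk. At `z = 0` the quotient is understood as its limit
`1`, so the origin is left out. -/
structure StarlikeOfOrder (α : ℝ) (g : ℂ → ℂ) : Prop where
  normalized : Normalized g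
  re_gt : ∀ z ∈ ball (0 : ℂ) 1, z ≠ 0 → α < (z * deriv g z / g z).re

/-- Subordination `f ≺ g` of functions on the unit disk. -/
def Subordinate (f g : ℂ → ℂ) : Prop :=
  ∃ w : ℂ → ℂ, DifferentiableOn ℂ w (ball 0 1) ∧ w 0 = 0 ∧
    (∀ z ∈ ball (0 : ℂ) 1, ‖w z‖ < 1) ∧ ∀ z ∈ ball (0 : ℂ) 1, f z = g (w z)

/-- The function `z ↦ -z² f'(z) / (g(z) g(-z))`, with its removable singularity at the origin
filled in by the limit `1`. -/
noncomputable def quotientFun (f g : ℂ → ℂ) (z : ℂ) : ℂ :=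
  if z = 0 then 1 else -(z ^ 2 * deriv f z / (g z * g (-z)))

/-- The class `𝒦ₛ(φ)`. -/
def ClassKs (φ : ℂ → ℂ) : Set (ℂ → ℂ) :=
  {f | Normalized f ∧ ∃ g, StarlikeOfOrder (1 / 2) g ∧ Subordinate (quotientFun f g) φ}

/-- Assumptions on `φ`: it is holomorphic and univalent with positive real part on the unit disk,
`φ 0 = 1`, and `φ (-r) = min_{|z| = r} |φ z|`, `φ r = max_{|z| = r} |φ z|` for `0 ≤ r < 1`
(in particular these two values are real). -/
structure Admissible (φ : ℂ → ℂ) : Prop where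
  differentiableOn : DifferentiableOn ℂ φ (ball 0 1)
  injOn : Set.InjOn φ (ball 0 1)
  re_pos : ∀ z ∈ ball (0 : ℂ) 1, 0 < (φ z).re
  map_zero : φ 0 = 1
  min_eq : ∀ r : ℝ, 0 ≤ r → r < 1 →
    ∃ m : ℝ, IsLeast ((fun z => ‖φ z‖) '' sphere (0 : ℂ) r) m ∧ φ (-(r : ℂ)) = (m : ℂ)
  max_eq : ∀ r : ℝ, 0 ≤ r → r < 1 →
    ∃ M : ℝ, IsGreatest ((fun z => ‖φ z‖) '' sphere (0 : ℂ) r) M ∧ φ (r : ℂ) = (M : ℂ)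

/-- The integral `∫₀^z h(w) dw` along the straight segment from `0` to `z`. -/
noncomputable def integralFromZero (h : ℂ → ℂ) (z : ℂ) : ℂ :=
  ∫ t in (0 : ℝ)..1, h ((t : ℂ) * z) * z

/-- `f₀(z) = ∫₀^z φ(w) / (1 - w²) dw`. -/
noncomputable def extremalUpper (φ : ℂ → ℂ) : ℂ → ℂ :=
  integralFromZero fun w => φ w / (1 - w ^ 2)

/-- `f₁(z) = ∫₀^z φ(w) / (1 + w²) dw`. -/
noncomputable def extremalLower (φ : ℂ → ℂ) : ℂ → ℂ :=
  integralFromZero fun w => φ w / (1 + w ^ 2)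

end CloseToConvex

/-!
Let `f ∈ 𝒦ₛ(φ)` with the starlike function `g` of order `1/2`. The function
`G(z) = -g(z) g(-z) / z` is odd and starlike, and the hypothesis on `f` says
`z f'(z) / G(z) = φ(w(z))` with a Schwarz function `w`.

*Bounds for `f'`.* As `z G'(z) / G(z)` is even with positive real part, the second order Schwarz
lemma bounds its real part, and integration along radii gives
`|z| / (1 + |z|²) ≤ |G(z)| ≤ |z| / (1 - |z|²)` (`StarlikeOfOrder.norm_symmProduct_bounds`).
Together with `φ(-r) ≤ |φ(w)| ≤ φ(r)` for `|w| ≤ r`, which is the maximum principle for `φ` and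
`1/φ` (`Admissible.norm_bounds`), this bounds `|f'|`.

*Bounds for `f`.* The upper bound is obtained by integrating along radii. The lower bound needs that
`f` is univalent. This is Kaplan's theorem on close-to-convex functions
(`injOn_of_re_deriv_div_pos`), proved here without geometric arguments: if some member of the family
`s f + (1 - s) G` identified two points, a pair with least maximal modulus would exist, by
compactness, and increasing the weight of `G` would move both points towards the origin. For a
univalent function, the minimum of `|f|` over a circle cannot be undercut outside that circle; so
one can follow the direction `-f / f'` from a minimum point without leaving the disc, and the lower
bound for `|f'|` integrates to one for `|f|` (`integral_le_norm_of_injOn`).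

*Sharpness.* The functions `g(z) = z / (1 - c z)` with `c = 1` and `c = i` give
`G(z) = z / (1 - z²)` and `G(z) = z / (1 + z²)`, so that `f₀` and `f₁` belong to `𝒦ₛ(φ)` with
`w(z) = z`. Since `φ` is positive on the real axis, the norms of the integrals over real segments are
the integrals of the norms.
-/

namespace CloseToConvex

/-! ### Symmetrized starlike functions -/

/-- The derivative of the modulus of a curve, written with the logarithmic derivative. -/
lemma hasDerivAt_norm_curve {γ : ℝ → ℂ} {γ' : ℂ} {t : ℝ} (h : HasDerivAt γ γ' t)
    (h0 : γ t ≠ 0) : HasDerivAt (fun s => ‖γ s‖) (‖γ t‖ * (γ' / γ t).re) t := by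
  have h1 := h.norm_sq.sqrt (by simpa using h0)
  simp only [Real.sqrt_sq (norm_nonneg _)] at h1
  convert h1 using 1
  have hn : ‖γ t‖ ≠ 0 := by simpa using h0
  rw [Complex.inner, Complex.div_re, Complex.normSq_eq_norm_sq]
  simp only [Complex.mul_re, Complex.conj_re, Complex.conj_im]
  field_simp
  ring

lemma neg_mem_unitBall {z : ℂ} (hz : z ∈ ball (0 : ℂ) 1) : -z ∈ ball (0 : ℂ) 1 := by
  simpa using hz

lemma smul_mem_unitBall {z : ℂ} (hz : z ∈ ball (0 : ℂ) 1) {t : ℝ} (ht : t ∈ Set.Icc (0 : ℝ) 1) :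
    (t : ℂ) * z ∈ ball (0 : ℂ) 1 := by
  rw [mem_ball_zero_iff] at *
  rw [norm_mul, Complex.norm_real, Real.norm_of_nonneg ht.1]
  nlinarith [norm_nonneg z, ht.2]

lemma hasDerivAt_of_mem_unitBall {f : ℂ → ℂ} (hf : DifferentiableOn ℂ f (ball 0 1)) {z : ℂ}
    (hz : z ∈ ball (0 : ℂ) 1) : HasDerivAt f (deriv f z) z :=
  (hf.differentiableAt (isOpen_ball.mem_nhds hz)).hasDerivAt

lemma hasDerivAt_radial {f : ℂ → ℂ} (hf : DifferentiableOn ℂ f (ball 0 1)) {z : ℂ}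
    {t : ℝ} (hz : (t : ℂ) * z ∈ ball (0 : ℂ) 1) :
    HasDerivAt (fun s : ℝ => f ((s : ℂ) * z)) (deriv f ((t : ℂ) * z) * z) t := by
  have h2 : HasDerivAt (fun s : ℝ => (s : ℂ) * z) (1 * z) t :=
    Complex.ofRealCLM.hasDerivAt.mul_const z
  rw [one_mul] at h2
  exact (hasDerivAt_of_mem_unitBall hf hz).comp t h2

section EvenFunction

variable {K : ℂ → ℂ}

/-- If `G(z) = z K(z)` is odd and starlike, then `z G'(z) / G(z) = 1 + z K'(z) / K(z)` is an even
function with positive real part. Its Cayley transform is therefore a Schwarz function vanishing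
to second order at the origin. -/
lemma norm_logDeriv_le_of_even (hd : DifferentiableOn ℂ K (ball 0 1))
    (hne : ∀ z ∈ ball (0 : ℂ) 1, K z ≠ 0) (heven : ∀ z, K (-z) = K z)
    (hre : ∀ z ∈ ball (0 : ℂ) 1, 0 < (1 + z * deriv K z / K z).re) {z : ℂ}
    (hz : z ∈ ball (0 : ℂ) 1) :
    ‖z * deriv K z / K z‖ ≤ ‖z‖ ^ 2 * ‖z * deriv K z / K z + 2‖ := by
  set A : ℂ → ℂ := fun z => z * deriv K z / K z with hA
  have hA2 : ∀ z ∈ ball (0 : ℂ) 1, A z + 2 ≠ 0 := fun z hz h => by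
    have h1 := hre z hz
    have h2 : (A z).re + 2 = 0 := by simpa using congrArg Complex.re h
    simp only [Complex.add_re, Complex.one_re] at h1
    change 0 < 1 + (A z).re at h1
    linarith
  have hAd : DifferentiableOn ℂ A (ball 0 1) :=
    (differentiableOn_id.mul (hd.deriv isOpen_ball)).div hd hne
  set W : ℂ → ℂ := fun z => A z / (A z + 2) with hW
  have hWd : DifferentiableOn ℂ W (ball 0 1) := hAd.div (hAd.add_const 2) hA2
  have hW0 : W 0 = 0 := by simp [hW, hA]
  have hAeven : ∀ z, A (-z) = A z := fun z => by
    have h1 : deriv K (-z) = - deriv K z := by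
      have h2 : deriv (fun x => K (-x)) z = deriv K z := by simp [heven]
      rw [deriv_comp_neg] at h2
      rw [← h2, neg_neg]
    simp [hA, h1, heven]
  have hWeven : ∀ z, W (-z) = W z := fun z => by simp [hW, hAeven]
  have hW' : HasDerivAt W 0 0 := by
    have h1 := hasDerivAt_of_mem_unitBall hWd (mem_ball_self one_pos)
    have h2 : deriv (fun x => W (-x)) 0 = deriv W 0 := by simp [hWeven]
    rw [deriv_comp_neg, neg_zero] at h2
    have h3 : deriv W 0 = 0 := by linear_combination (-1 / 2) * h2
    rwa [h3] at h1
  have hmaps : Set.MapsTo W (ball 0 1) (closedBall (W 0) 1) := fun z hz => by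
    rw [hW0, mem_closedBall_zero_iff, hW, norm_div]
    refine div_le_one_of_le₀ ?_ (norm_nonneg _)
    have h1 := hre z hz
    change 0 < (1 + A z).re at h1
    rw [← sq_le_sq₀ (norm_nonneg _) (norm_nonneg _), Complex.sq_norm, Complex.sq_norm,
      Complex.normSq_apply, Complex.normSq_apply]
    simp at h1 ⊢
    nlinarith
  have hlit : (fun z => W z - W 0) =o[nhds 0] (fun w => ‖w - 0‖ ^ 1) := by
    have h1 := hW'.isLittleO
    simp only [smul_zero, sub_zero] at h1
    simpa using h1.norm_right
  have h1 := Complex.dist_le_mul_div_pow_of_mapsTo_ball_of_isLittleO hWd hmaps hlit hz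
  rw [hW0, dist_zero_right, dist_zero_right, hW, norm_div,
    div_le_iff₀ (norm_pos_iff.2 (hA2 z hz))] at h1
  simpa only [sub_zero, div_one, one_mul, one_add_one_eq_two, dist_zero_right] using h1

/-- Solving `|A| ≤ ρ |A + 2|` for the real part: `-2ρ / (1 + ρ) ≤ Re A ≤ 2ρ / (1 - ρ)`, where
`A = z K'(z) / K(z)` and `ρ = |z|²`. -/
lemma re_logDeriv_bounds (hd : DifferentiableOn ℂ K (ball 0 1))
    (hne : ∀ z ∈ ball (0 : ℂ) 1, K z ≠ 0) (heven : ∀ z, K (-z) = K z)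
    (hre : ∀ z ∈ ball (0 : ℂ) 1, 0 < (1 + z * deriv K z / K z).re) {z : ℂ}
    (hz : z ∈ ball (0 : ℂ) 1) :
    (z * deriv K z / K z).re * (1 - ‖z‖ ^ 2) ≤ 2 * ‖z‖ ^ 2 ∧
      -(2 * ‖z‖ ^ 2) ≤ (z * deriv K z / K z).re * (1 + ‖z‖ ^ 2) := by
  have h1 := norm_logDeriv_le_of_even hd hne heven hre hz
  have h2 := hre z hz
  set a := z * deriv K z / K z
  rw [mem_ball_zero_iff] at hz
  set ρ := ‖z‖ ^ 2 with hρ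
  have hρ0 : 0 ≤ ρ := by positivity
  have hρ1 : ρ < 1 := by rw [hρ]; nlinarith [norm_nonneg z]
  have h3 : 0 < 1 + a.re := by simpa using h2
  have h4 : ‖a‖ ^ 2 ≤ ρ ^ 2 * ‖a + 2‖ ^ 2 := by
    rw [← mul_pow]; exact pow_le_pow_left₀ (norm_nonneg _) h1 2
  rw [Complex.sq_norm, Complex.sq_norm, Complex.normSq_apply, Complex.normSq_apply] at h4
  simp at h4
  have h5 : a.re ^ 2 ≤ (ρ * (a.re + 2)) ^ 2 := by
    have : 0 ≤ a.im ^ 2 * (1 - ρ ^ 2) := mul_nonneg (sq_nonneg _) (by nlinarith)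
    nlinarith
  have h6 := abs_le_of_sq_le_sq' h5 (mul_nonneg hρ0 (by linarith))
  constructor <;> nlinarith [h6.1, h6.2]

lemma hasDerivAt_radial_norm_mul (hd : DifferentiableOn ℂ K (ball 0 1))
    (hne : ∀ z ∈ ball (0 : ℂ) 1, K z ≠ 0) {z : ℂ} (hz : z ∈ ball (0 : ℂ) 1) (c : ℝ)
    {t : ℝ} (ht : t ∈ Set.Icc (0 : ℝ) 1) :
    HasDerivAt (fun s : ℝ => ‖K ((s : ℂ) * z)‖ * (1 + c * s ^ 2))
      (‖K ((t : ℂ) * z)‖ *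
        ((deriv K ((t : ℂ) * z) * z / K ((t : ℂ) * z)).re * (1 + c * t ^ 2) + 2 * c * t)) t := by
  have hm := smul_mem_unitBall hz ht
  have h1 := hasDerivAt_norm_curve (hasDerivAt_radial hd hm) (hne _ hm)
  have h2 : HasDerivAt (fun s : ℝ => 1 + c * s ^ 2) (c * (2 * t)) t := by
    simpa using ((hasDerivAt_pow 2 t).const_mul c).const_add 1
  exact (h1.mul h2).congr_deriv (by ring)

/-- Growth theorem for odd starlike functions `G(z) = z K(z)`:
`|z| / (1 + |z|²) ≤ |G(z)| ≤ |z| / (1 - |z|²)`. -/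
lemma norm_bounds_of_even (hd : DifferentiableOn ℂ K (ball 0 1)) (h0 : K 0 = 1)
    (hne : ∀ z ∈ ball (0 : ℂ) 1, K z ≠ 0) (heven : ∀ z, K (-z) = K z)
    (hre : ∀ z ∈ ball (0 : ℂ) 1, 0 < (1 + z * deriv K z / K z).re) {z : ℂ}
    (hz : z ∈ ball (0 : ℂ) 1) :
    ‖K z‖ * (1 - ‖z‖ ^ 2) ≤ 1 ∧ 1 ≤ ‖K z‖ * (1 + ‖z‖ ^ 2) := by
  have key : ∀ t ∈ Set.Ioo (0 : ℝ) 1,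
      (deriv K ((t : ℂ) * z) * z / K ((t : ℂ) * z)).re * (1 - ‖z‖ ^ 2 * t ^ 2) ≤
        2 * ‖z‖ ^ 2 * t ∧ -(2 * ‖z‖ ^ 2 * t) ≤
      (deriv K ((t : ℂ) * z) * z / K ((t : ℂ) * z)).re * (1 + ‖z‖ ^ 2 * t ^ 2) := by
    intro t ht
    have h1 := re_logDeriv_bounds hd hne heven hre (smul_mem_unitBall hz ⟨ht.1.le, ht.2.le⟩)
    have e1 : ((t : ℂ) * z * deriv K ((t : ℂ) * z) / K ((t : ℂ) * z)).re =
        t * (deriv K ((t : ℂ) * z) * z / K ((t : ℂ) * z)).re := by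
      rw [← Complex.re_ofReal_mul]; congr 1; ring
    rw [e1, norm_mul, Complex.norm_real, Real.norm_of_nonneg ht.1.le] at h1
    constructor
    · refine le_of_mul_le_mul_left ?_ ht.1
      nlinarith [h1.1]
    · refine le_of_mul_le_mul_left ?_ ht.1
      nlinarith [h1.2]
  have hD := fun c t (ht : t ∈ Set.Icc (0 : ℝ) 1) => hasDerivAt_radial_norm_mul hd hne hz c ht
  constructor
  · have := antitoneOn_of_deriv_nonpos (convex_Icc (0 : ℝ) 1)
      (fun t ht => (hD (-‖z‖ ^ 2) t ht).continuousAt.continuousWithinAt)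
      (fun t ht => (hD (-‖z‖ ^ 2) t (interior_subset ht)).differentiableAt.differentiableWithinAt)
      (fun t ht => by
        rw [(hD (-‖z‖ ^ 2) t (interior_subset ht)).deriv]
        rw [interior_Icc] at ht
        refine mul_nonpos_of_nonneg_of_nonpos (norm_nonneg _) ?_
        nlinarith [(key t ht).1])
      (Set.left_mem_Icc.2 zero_le_one) (Set.right_mem_Icc.2 zero_le_one) zero_le_one
    simpa [h0, sub_eq_add_neg] using this
  · have := monotoneOn_of_deriv_nonneg (convex_Icc (0 : ℝ) 1)
      (fun t ht => (hD (‖z‖ ^ 2) t ht).continuousAt.continuousWithinAt)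
      (fun t ht => (hD (‖z‖ ^ 2) t (interior_subset ht)).differentiableAt.differentiableWithinAt)
      (fun t ht => by
        rw [(hD (‖z‖ ^ 2) t (interior_subset ht)).deriv]
        rw [interior_Icc] at ht
        refine mul_nonneg (norm_nonneg _) ?_
        nlinarith [(key t ht).2])
      (Set.left_mem_Icc.2 zero_le_one) (Set.right_mem_Icc.2 zero_le_one) zero_le_one
    simpa [h0] using this

end EvenFunction

/-- The function `-g(z) g(-z) / z²`, with its removable singularity filled in. If `g` is starlike
of order `1/2`, then `z ↦ z * symmProduct g z` is an odd starlike function. -/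
noncomputable def symmProduct (g : ℂ → ℂ) (z : ℂ) : ℂ := dslope g 0 z * dslope g 0 (-z)

lemma symmProduct_neg (g : ℂ → ℂ) (z : ℂ) : symmProduct g (-z) = symmProduct g z := by
  simp [symmProduct, mul_comm]

lemma Normalized.mul_dslope {g : ℂ → ℂ} (hg : Normalized g) (z : ℂ) :
    z * dslope g 0 z = g z := by
  simpa [hg.map_zero] using sub_smul_dslope g 0 z

lemma Normalized.dslope_zero {g : ℂ → ℂ} (hg : Normalized g) : dslope g 0 0 = 1 := by
  rw [dslope_same, hg.deriv_zero]

lemma Normalized.differentiableOn_dslope {g : ℂ → ℂ} (hg : Normalized g) :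
    DifferentiableOn ℂ (dslope g 0) (ball 0 1) :=
  (Complex.differentiableOn_dslope (ball_mem_nhds 0 one_pos)).2 hg.differentiableOn

lemma Normalized.mul_deriv_dslope {g : ℂ → ℂ} (hg : Normalized g) {z : ℂ}
    (hz : z ∈ ball (0 : ℂ) 1) : z * deriv (dslope g 0) z = deriv g z - dslope g 0 z := by
  have h1 := (hasDerivAt_id z).mul (hasDerivAt_of_mem_unitBall hg.differentiableOn_dslope hz)
  have h2 : (id * dslope g 0 : ℂ → ℂ) = g := by
    ext x; simpa using hg.mul_dslope x
  rw [h2] at h1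
  rw [h1.deriv]
  simp

lemma Normalized.symmProduct_zero {g : ℂ → ℂ} (hg : Normalized g) : symmProduct g 0 = 1 := by
  simp [symmProduct, hg.deriv_zero]

lemma Normalized.sq_mul_symmProduct {g : ℂ → ℂ} (hg : Normalized g) (z : ℂ) :
    z ^ 2 * symmProduct g z = -(g z * g (-z)) := by
  rw [← hg.mul_dslope z, ← hg.mul_dslope (-z), symmProduct]; ring

lemma Normalized.differentiableOn_symmProduct {g : ℂ → ℂ} (hg : Normalized g) :
    DifferentiableOn ℂ (symmProduct g) (ball 0 1) :=
  hg.differentiableOn_dslope.mul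
    (hg.differentiableOn_dslope.comp differentiableOn_id.neg fun _ hz => neg_mem_unitBall hz)

lemma StarlikeOfOrder.dslope_ne_zero {α : ℝ} (hα : 0 ≤ α) {g : ℂ → ℂ} (hg : StarlikeOfOrder α g)
    {z : ℂ} (hz : z ∈ ball (0 : ℂ) 1) : dslope g 0 z ≠ 0 := by
  intro h
  rcases eq_or_ne z 0 with rfl | hz0
  · rw [hg.normalized.dslope_zero] at h
    exact one_ne_zero h
  · have h1 := hg.re_gt z hz hz0
    have h2 := hg.normalized.mul_dslope z
    rw [h, mul_zero] at h2
    rw [← h2] at h1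
    simp at h1
    linarith

lemma StarlikeOfOrder.lt_re_deriv_div_dslope {α : ℝ} (hα1 : α < 1) {g : ℂ → ℂ}
    (hg : StarlikeOfOrder α g) {z : ℂ} (hz : z ∈ ball (0 : ℂ) 1) :
    α < (deriv g z / dslope g 0 z).re := by
  rcases eq_or_ne z 0 with rfl | hz0
  · simpa [hg.normalized.deriv_zero] using hα1
  · have h1 := hg.re_gt z hz hz0
    rwa [← hg.normalized.mul_dslope z, mul_div_mul_left _ _ hz0] at h1

lemma StarlikeOfOrder.symmProduct_ne_zero {g : ℂ → ℂ} (hg : StarlikeOfOrder (1 / 2) g)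
    {z : ℂ} (hz : z ∈ ball (0 : ℂ) 1) : symmProduct g z ≠ 0 :=
  mul_ne_zero (hg.dslope_ne_zero (by norm_num) hz)
    (hg.dslope_ne_zero (by norm_num) (neg_mem_unitBall hz))

/-- The odd function `G(z) = -g(z) g(-z) / z` is starlike, because
`z G'(z) / G(z) = z g'(z) / g(z) + (-z) g'(-z) / g(-z) - 1`. -/
lemma StarlikeOfOrder.re_symmProduct_pos {g : ℂ → ℂ} (hg : StarlikeOfOrder (1 / 2) g)
    {z : ℂ} (hz : z ∈ ball (0 : ℂ) 1) :
    0 < (1 + z * deriv (symmProduct g) z / symmProduct g z).re := by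
  have hz' := neg_mem_unitBall hz
  have n1 := hg.dslope_ne_zero (by norm_num) hz
  have n2 := hg.dslope_ne_zero (by norm_num) hz'
  have hd := hg.normalized.differentiableOn_dslope
  have h1 : HasDerivAt (symmProduct g) (deriv (dslope g 0) z * dslope g 0 (-z) +
      dslope g 0 z * -deriv (dslope g 0) (-z)) z := by
    refine (hasDerivAt_of_mem_unitBall hd hz).mul ?_
    have h2 := (hasDerivAt_of_mem_unitBall hd hz').comp z (hasDerivAt_neg z)
    rwa [mul_neg_one] at h2
  have e1 := hg.normalized.mul_deriv_dslope hz
  have e2 := hg.normalized.mul_deriv_dslope hz'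
  have e : 1 + z * deriv (symmProduct g) z / symmProduct g z =
      deriv g z / dslope g 0 z + deriv g (-z) / dslope g 0 (-z) - 1 := by
    rw [h1.deriv, symmProduct]
    field_simp
    linear_combination dslope g 0 (-z) * e1 + dslope g 0 z * e2
  have p1 := hg.lt_re_deriv_div_dslope (by norm_num) hz
  have p2 := hg.lt_re_deriv_div_dslope (by norm_num) hz'
  rw [e]
  simp only [Complex.add_re, Complex.sub_re, Complex.one_re]
  linarith

lemma StarlikeOfOrder.norm_symmProduct_bounds {g : ℂ → ℂ} (hg : StarlikeOfOrder (1 / 2) g)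
    {z : ℂ} (hz : z ∈ ball (0 : ℂ) 1) :
    ‖symmProduct g z‖ * (1 - ‖z‖ ^ 2) ≤ 1 ∧ 1 ≤ ‖symmProduct g z‖ * (1 + ‖z‖ ^ 2) :=
  norm_bounds_of_even hg.normalized.differentiableOn_symmProduct hg.normalized.symmProduct_zero
    (fun _ h => hg.symmProduct_ne_zero h) (symmProduct_neg g)
    (fun _ h => hg.re_symmProduct_pos h) hz

/-! ### Univalence of close-to-convex functions -/

lemma hasStrictDerivAt_of_mem_unitBall {f : ℂ → ℂ} (hf : DifferentiableOn ℂ f (ball 0 1)) {z : ℂ}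
    (hz : z ∈ ball (0 : ℂ) 1) : HasStrictDerivAt f (deriv f z) z :=
  ((hf.analyticAt (isOpen_ball.mem_nhds hz)).contDiffAt (n := 1)).hasStrictDerivAt (by simp)

/-- The difference quotient of a holomorphic function, extended by the derivative to the diagonal,
is jointly continuous. -/
lemma continuousAt_dslope_uncurry {f : ℂ → ℂ} (hf : DifferentiableOn ℂ f (ball 0 1)) {p : ℂ × ℂ}
    (h1 : p.1 ∈ ball (0 : ℂ) 1) (h2 : p.2 ∈ ball (0 : ℂ) 1) :
    ContinuousAt (fun q : ℂ × ℂ => dslope f q.1 q.2) p := by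
  obtain ⟨a, b⟩ := p
  have c1 : ContinuousAt f a := (hf.differentiableAt (isOpen_ball.mem_nhds h1)).continuousAt
  have c2 : ContinuousAt f b := (hf.differentiableAt (isOpen_ball.mem_nhds h2)).continuousAt
  rcases ne_or_eq b a with hab | rfl
  · have hev : (fun q : ℂ × ℂ => (q.2 - q.1)⁻¹ * (f q.2 - f q.1)) =ᶠ[nhds (a, b)]
        fun q => dslope f q.1 q.2 := by
      have : ∀ᶠ q : ℂ × ℂ in nhds (a, b), q.2 ≠ q.1 :=
        (isOpen_ne_fun continuous_snd continuous_fst).mem_nhds hab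
      filter_upwards [this] with q hq
      rw [dslope_of_ne _ hq, slope_def_module, smul_eq_mul]
    refine ContinuousAt.congr ?_ hev
    have c1' : ContinuousAt (fun q : ℂ × ℂ => f q.1) (a, b) :=
      ContinuousAt.comp (f := Prod.fst) (g := f) c1 continuousAt_fst
    have c2' : ContinuousAt (fun q : ℂ × ℂ => f q.2) (a, b) :=
      ContinuousAt.comp (f := Prod.snd) (g := f) c2 continuousAt_snd
    exact ((continuousAt_snd.sub continuousAt_fst).inv₀ (sub_ne_zero.2 hab)).mul (c2'.sub c1')
  · have hs := (hasStrictDerivAt_of_mem_unitBall hf h1).isLittleO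
    have hc : ContinuousAt (deriv f) b :=
      ((hf.deriv isOpen_ball).differentiableAt (isOpen_ball.mem_nhds h1)).continuousAt
    have hc' : ContinuousAt (fun q : ℂ × ℂ => deriv f q.1) (b, b) :=
      ContinuousAt.comp (f := Prod.fst) (g := deriv f) hc continuousAt_fst
    rw [Metric.continuousAt_iff'] at hc' ⊢
    intro ε hε
    filter_upwards [hs.def (half_pos hε), hc' ε hε] with q hq hq'
    obtain ⟨x, y⟩ := q
    rw [dslope_same, dist_eq_norm]
    rcases ne_or_eq y x with hxy | rfl
    · have h0 : 0 < ‖y - x‖ := norm_pos_iff.2 (sub_ne_zero.2 hxy)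
      have e : f x - f y - (x - y) • deriv f b = -(y - x) * (dslope f x y - deriv f b) := by
        have := sub_smul_dslope f x y
        simp only [smul_eq_mul] at this ⊢
        linear_combination this
      simp only [ContinuousLinearMap.toSpanSingleton_apply] at hq
      rw [e, norm_mul, norm_neg, norm_sub_rev x y, mul_comm] at hq
      have := le_of_mul_le_mul_right hq h0
      change ‖dslope f x y - deriv f b‖ < ε
      linarith
    · rw [dist_eq_norm] at hq'
      change ‖dslope f y y - deriv f b‖ < ε
      rwa [dslope_same]

lemma continuousAt_comp_forget_third {D : ℂ × ℂ → ℂ} {p : ℂ × ℂ × ℝ}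
    (hD : ContinuousAt D (p.1, p.2.1)) :
    ContinuousAt (fun p : ℂ × ℂ × ℝ => D (p.1, p.2.1)) p := by
  have hproj : Filter.Tendsto (fun p : ℂ × ℂ × ℝ => (p.1, p.2.1)) (nhds p) (nhds (p.1, p.2.1)) :=
    (Continuous.prodMk continuous_fst (continuous_fst.comp continuous_snd)).tendsto p
  exact hD.tendsto.comp hproj

lemma eventually_lt_of_hasDerivAt_neg {k : ℝ → ℝ} {k' : ℝ} (h : HasDerivAt k k' 0) (hk : k' < 0) :
    ∀ᶠ δ in nhdsWithin (0 : ℝ) (Set.Ioi 0), k δ < k 0 := by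
  have h1 := (hasDerivAt_iff_tendsto_slope.1 h).eventually (gt_mem_nhds hk)
  have h2 : nhdsWithin (0 : ℝ) (Set.Ioi 0) ≤ nhdsWithin 0 {0}ᶜ :=
    nhdsWithin_mono _ fun x hx => ne_of_gt hx
  filter_upwards [h2 h1, self_mem_nhdsWithin] with δ hδ hδ0
  have hδ0 : (0 : ℝ) < δ := hδ0
  rw [slope_def_field, sub_zero, div_neg_iff] at hδ
  rcases hδ with h | h
  · linarith [h.2]
  · linarith [h.1]

/-- If `Re (z F'(z) / G(z)) > 0` at `z₀`, then the solution `ζ(δ)` of `F(ζ) + δ G(ζ) = F(z₀)`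
starting at `z₀` moves towards the origin as `δ` increases from `0`, and stays there if `z₀ = 0`.
Here `G(z) = z K(z)`; the radius `r > 0` covers both cases. -/
lemma exists_inward_perturbation {F K : ℂ → ℂ} (hF : DifferentiableOn ℂ F (ball 0 1))
    (hK : DifferentiableOn ℂ K (ball 0 1)) {z₀ : ℂ} (hz : z₀ ∈ ball (0 : ℂ) 1)
    (hK0 : K z₀ ≠ 0) (hre : 0 < (deriv F z₀ / K z₀).re) {r : ℝ} (hr : 0 < r) (hzr : ‖z₀‖ ≤ r) :
    ∃ ζ : ℝ → ℂ, Filter.Tendsto ζ (nhdsWithin 0 (Set.Ioi 0)) (nhds z₀) ∧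
      ∀ᶠ δ in nhdsWithin (0 : ℝ) (Set.Ioi 0),
        F (ζ δ) + δ * (ζ δ * K (ζ δ)) = F z₀ ∧ ‖ζ δ‖ < r := by
  rcases eq_or_ne z₀ 0 with rfl | hz0
  · exact ⟨fun _ => 0, tendsto_const_nhds, Filter.Eventually.of_forall fun δ => by simp [hr]⟩
  have hF' : deriv F z₀ ≠ 0 := fun h => by simp [h] at hre
  -- The equation reads `Ψ(ζ) = δ`, and `Ψ` is locally invertible at `z₀`.
  set Ψ : ℂ → ℂ := fun z => (F z₀ - F z) / (z * K z) with hΨ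
  have hG := (hasStrictDerivAt_id z₀).mul (hasStrictDerivAt_of_mem_unitBall hK hz)
  have hΨ' : HasStrictDerivAt Ψ (-(deriv F z₀) / (z₀ * K z₀)) z₀ := by
    have h1 := ((hasStrictDerivAt_of_mem_unitBall hF hz).const_sub (F z₀)).div hG
      (mul_ne_zero hz0 hK0)
    refine h1.congr_deriv ?_
    simp only [Pi.mul_apply, id]
    field_simp
    ring
  have hne : -(deriv F z₀) / (z₀ * K z₀) ≠ 0 :=
    div_ne_zero (neg_ne_zero.2 hF') (mul_ne_zero hz0 hK0)
  have hΨ0 : Ψ z₀ = 0 := by simp [hΨ]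
  have hinv := (hΨ'.to_localInverse hne).hasDerivAt
  have hright : ∀ᶠ w in nhds (0 : ℂ), Ψ (hΨ'.localInverse Ψ _ z₀ hne w) = w := by
    have := HasStrictFDerivAt.eventually_right_inverse
      (hΨ'.hasStrictFDerivAt_equiv hne)
    rwa [hΨ0] at this
  have hval : hΨ'.localInverse Ψ _ z₀ hne 0 = z₀ := by
    have := HasStrictFDerivAt.localInverse_apply_image (hΨ'.hasStrictFDerivAt_equiv hne)
    rwa [hΨ0] at this
  set I := hΨ'.localInverse Ψ _ z₀ hne
  rw [hΨ0] at hinv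
  have hcurve : HasDerivAt (fun δ : ℝ => I (δ : ℂ)) ((-(deriv F z₀) / (z₀ * K z₀))⁻¹) 0 := by
    have := HasDerivAt.comp_ofReal (e := I) (z := 0) (by simpa using hinv)
    simpa using this
  have hcont : Filter.Tendsto (fun δ : ℝ => I (δ : ℂ)) (nhds 0) (nhds z₀) := by
    have := hcurve.continuousAt.tendsto
    simpa [hval] using this
  have hcont' := hcont.mono_left (nhdsWithin_le_nhds (s := Set.Ioi (0 : ℝ)))
  refine ⟨fun δ => I (δ : ℂ), hcont', ?_⟩
  have hn := hasDerivAt_norm_curve hcurve (by simpa [hval] using hz0)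
  simp only [Complex.ofReal_zero, hval] at hn
  have hneg : ‖z₀‖ * ((-(deriv F z₀) / (z₀ * K z₀))⁻¹ / z₀).re < 0 := by
    have e : (-(deriv F z₀) / (z₀ * K z₀))⁻¹ / z₀ = -(deriv F z₀ / K z₀)⁻¹ := by
      field_simp
    rw [e, Complex.neg_re, Complex.inv_re]
    have : 0 < Complex.normSq (deriv F z₀ / K z₀) :=
      Complex.normSq_pos.2 (div_ne_zero hF' hK0)
    have h2 := div_pos hre this
    have h3 : 0 < ‖z₀‖ := norm_pos_iff.2 hz0
    nlinarith
  have hlt : ∀ᶠ δ : ℝ in nhdsWithin 0 (Set.Ioi 0), ‖I (δ : ℂ)‖ < ‖z₀‖ := by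
    simpa [hval] using eventually_lt_of_hasDerivAt_neg hn hneg
  have hofReal : Filter.Tendsto (fun δ : ℝ => (δ : ℂ)) (nhdsWithin 0 (Set.Ioi 0)) (nhds 0) := by
    have := Complex.continuous_ofReal.tendsto 0
    rw [Complex.ofReal_zero] at this
    exact this.mono_left nhdsWithin_le_nhds
  have hGne : ∀ᶠ z in nhds z₀, z * K z ≠ 0 :=
    hG.hasDerivAt.continuousAt.eventually_ne (mul_ne_zero hz0 hK0)
  filter_upwards [hlt, hofReal.eventually hright, hcont'.eventually hGne] with δ h1 h2 h3
  refine ⟨?_, h1.trans_le hzr⟩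
  simp only [hΨ] at h2
  rw [div_eq_iff h3] at h2
  rw [← h2]; ring

/-- Among all pairs of distinct points of a closed disc that are identified by a member of the
family `s f + (1 - s) G`, `0 ≤ s ≤ 1`, there is one with the least `max |zᵢ|`, provided that all
members of the family are locally univalent. Local univalence makes the set of such pairs compact,
as it is then the zero set of the extended difference quotient. -/
lemma exists_minimal_identified_pair {f G : ℂ → ℂ} (hf : DifferentiableOn ℂ f (ball 0 1))
    (hG : DifferentiableOn ℂ G (ball 0 1)) {R : ℝ} (hR : R < 1)
    (hne : ∀ s ∈ Set.Icc (0 : ℝ) 1, ∀ z ∈ closedBall (0 : ℂ) R,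
      (s : ℂ) * deriv f z + (1 - s) * deriv G z ≠ 0)
    (hex : ∃ z₁ ∈ closedBall (0 : ℂ) R, ∃ z₂ ∈ closedBall (0 : ℂ) R, z₁ ≠ z₂ ∧ f z₁ = f z₂) :
    ∃ z₁ ∈ closedBall (0 : ℂ) R, ∃ z₂ ∈ closedBall (0 : ℂ) R, ∃ s ∈ Set.Icc (0 : ℝ) 1,
      (z₁ ≠ z₂ ∧ (s : ℂ) * f z₁ + (1 - s) * G z₁ = s * f z₂ + (1 - s) * G z₂) ∧
      ∀ w₁ ∈ closedBall (0 : ℂ) R, ∀ w₂ ∈ closedBall (0 : ℂ) R, ∀ s' ∈ Set.Icc (0 : ℝ) 1,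
        w₁ ≠ w₂ → (s' : ℂ) * f w₁ + (1 - s') * G w₁ = s' * f w₂ + (1 - s') * G w₂ →
        max ‖z₁‖ ‖z₂‖ ≤ max ‖w₁‖ ‖w₂‖ := by
  have hsub : closedBall (0 : ℂ) R ⊆ ball 0 1 := closedBall_subset_ball hR
  set C : Set (ℂ × ℂ × ℝ) := closedBall 0 R ×ˢ closedBall 0 R ×ˢ Set.Icc (0 : ℝ) 1 with hC
  have hCc : IsCompact C :=
    (isCompact_closedBall _ _).prod ((isCompact_closedBall _ _).prod isCompact_Icc)
  set Q : ℂ × ℂ × ℝ → ℂ := fun p =>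
    (p.2.2 : ℂ) * dslope f p.1 p.2.1 + (1 - (p.2.2 : ℂ)) * dslope G p.1 p.2.1 with hQ
  have hQc : ContinuousOn Q C := by
    intro p hp
    have hp1 := hsub hp.1
    have hp2 := hsub hp.2.1
    have hs : ContinuousAt (fun p : ℂ × ℂ × ℝ => (p.2.2 : ℂ)) p := by fun_prop
    have a1 := continuousAt_comp_forget_third
      (continuousAt_dslope_uncurry hf (p := (p.1, p.2.1)) hp1 hp2)
    have a2 := continuousAt_comp_forget_third
      (continuousAt_dslope_uncurry hG (p := (p.1, p.2.1)) hp1 hp2)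
    have h : ContinuousAt Q p := (hs.mul a1).add ((continuousAt_const.sub hs).mul a2)
    exact h.continuousWithinAt
  have hQ0 : ∀ z₁ ∈ closedBall (0 : ℂ) R, ∀ z₂ ∈ closedBall (0 : ℂ) R, ∀ s ∈ Set.Icc (0 : ℝ) 1,
      Q (z₁, z₂, s) = 0 ↔
        z₁ ≠ z₂ ∧ (s : ℂ) * f z₁ + (1 - s) * G z₁ = s * f z₂ + (1 - s) * G z₂ := by
    intro z₁ h₁ z₂ h₂ s hs
    simp only [hQ]
    rcases eq_or_ne z₁ z₂ with rfl | hz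
    · simpa [dslope_same] using hne s hs z₁ h₁
    · have e1 := sub_smul_dslope f z₁ z₂
      have e2 := sub_smul_dslope G z₁ z₂
      simp only [smul_eq_mul] at e1 e2
      have hz' : z₂ - z₁ ≠ 0 := sub_ne_zero.2 hz.symm
      rw [and_iff_right hz, ← mul_right_inj' hz', mul_zero]
      generalize dslope f z₁ z₂ = u at *
      generalize dslope G z₁ z₂ = v at *
      constructor
      · intro h
        linear_combination -h + (s : ℂ) * e1 + (1 - (s : ℂ)) * e2
      · intro h
        linear_combination -h + (s : ℂ) * e1 + (1 - (s : ℂ)) * e2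
  have hSc : IsCompact (C ∩ Q ⁻¹' {0}) := hCc.of_isClosed_subset
    (hQc.preimage_isClosed_of_isClosed hCc.isClosed isClosed_singleton) Set.inter_subset_left
  obtain ⟨a, ha, b, hb, hab, hfab⟩ := hex
  have h1 : (1 : ℝ) ∈ Set.Icc (0 : ℝ) 1 := ⟨zero_le_one, le_refl (1 : ℝ)⟩
  have hSn : (C ∩ Q ⁻¹' {0}).Nonempty :=
    ⟨(a, b, 1), ⟨ha, hb, h1⟩, (hQ0 a ha b hb 1 h1).2 ⟨hab, by simp [hfab]⟩⟩
  have hcont : Continuous fun p : ℂ × ℂ × ℝ => max ‖p.1‖ ‖p.2.1‖ := by fun_prop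
  obtain ⟨⟨z₁, z₂, s⟩, ⟨⟨m₁, m₂, ms⟩, m0⟩, hmin⟩ := hSc.exists_isMinOn hSn hcont.continuousOn
  refine ⟨z₁, m₁, z₂, m₂, s, ms, (hQ0 z₁ m₁ z₂ m₂ s ms).1 m0, ?_⟩
  intro w₁ n₁ w₂ n₂ s' ns hw hF
  exact hmin (a := (w₁, w₂, s')) ⟨⟨n₁, n₂, ns⟩, (hQ0 w₁ n₁ w₂ n₂ s' ns).2 ⟨hw, hF⟩⟩

/-- Univalence criterion of Kaplan: `f` is univalent if `G(z) = z K(z)` is starlike and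
`Re (z f'(z) / G(z)) > 0`. A minimal pair of distinct points identified by `F = s f + (1 - s) G`
cannot exist: passing from `F` to `F + δ G`, which is a multiple of another member of the family,
moves both points inwards. -/
theorem injOn_of_re_deriv_div_pos {f K : ℂ → ℂ} (hf : DifferentiableOn ℂ f (ball 0 1))
    (hK : DifferentiableOn ℂ K (ball 0 1)) (hne : ∀ z ∈ ball (0 : ℂ) 1, K z ≠ 0)
    (hfre : ∀ z ∈ ball (0 : ℂ) 1, 0 < (deriv f z / K z).re)
    (hKre : ∀ z ∈ ball (0 : ℂ) 1, 0 < (1 + z * deriv K z / K z).re) :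
    Set.InjOn f (ball 0 1) := by
  set G : ℂ → ℂ := fun z => z * K z with hG
  have hGd : DifferentiableOn ℂ G (ball 0 1) := differentiableOn_id.mul hK
  have hGre : ∀ z ∈ ball (0 : ℂ) 1, 0 < (deriv G z / K z).re := fun z hz => by
    have h1 : HasDerivAt G (1 * K z + z * deriv K z) z :=
      (hasDerivAt_id z).mul (hasDerivAt_of_mem_unitBall hK hz)
    have h2 := hKre z hz
    rw [h1.deriv, one_mul, add_div, div_self (hne z hz)]
    exact h2
  have hre : ∀ s ∈ Set.Icc (0 : ℝ) 1, ∀ z ∈ ball (0 : ℂ) 1,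
      0 < (((s : ℂ) * deriv f z + (1 - s) * deriv G z) / K z).re := by
    intro s hs z hz
    have e : ((s : ℂ) * deriv f z + (1 - s) * deriv G z) / K z =
        (s : ℂ) * (deriv f z / K z) + ((1 - s : ℝ) : ℂ) * (deriv G z / K z) := by
      push_cast; ring
    rw [e, Complex.add_re, Complex.re_ofReal_mul, Complex.re_ofReal_mul]
    have p1 := hfre z hz
    have p2 := hGre z hz
    rcases eq_or_lt_of_le hs.1 with h | h
    · rw [← h]; simpa using p2
    · have := mul_pos h p1
      have := mul_nonneg (sub_nonneg.2 hs.2) p2.le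
      linarith
  intro a ha b hb hab
  by_contra hne_ab
  rw [mem_ball_zero_iff] at ha hb
  set R := max ‖a‖ ‖b‖ with hRdef
  have hR : R < 1 := max_lt ha hb
  have hsub : closedBall (0 : ℂ) R ⊆ ball 0 1 := closedBall_subset_ball hR
  obtain ⟨z₁, m₁, z₂, m₂, s, hs, ⟨h12, hFeq⟩, hmin⟩ :=
    exists_minimal_identified_pair hf hGd hR
      (fun s hs z hz h => by
        have := hre s hs z (hsub hz)
        rw [h] at this
        simp at this)
      ⟨a, by simp [hRdef], b, by simp [hRdef], hne_ab, hab⟩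
  set F : ℂ → ℂ := fun z => s * f z + (1 - s) * G z with hF
  have hFd : DifferentiableOn ℂ F (ball 0 1) := (hf.const_mul _).add (hGd.const_mul _)
  have hFre : ∀ z ∈ ball (0 : ℂ) 1, 0 < (deriv F z / K z).re := fun z hz => by
    have h1 : HasDerivAt F (s * deriv f z + (1 - s) * deriv G z) z :=
      ((hasDerivAt_of_mem_unitBall hf hz).const_mul _).add
        ((hasDerivAt_of_mem_unitBall hGd hz).const_mul _)
    rw [h1.deriv]
    exact hre s hs z hz
  have hz₁ := hsub m₁
  have hz₂ := hsub m₂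
  set r := max ‖z₁‖ ‖z₂‖ with hr
  have hr0 : 0 < r := by
    rcases eq_or_ne z₁ 0 with h | h
    · exact lt_max_of_lt_right (norm_pos_iff.2 fun h' => h12 (h.trans h'.symm))
    · exact lt_max_of_lt_left (norm_pos_iff.2 h)
  have hrR : r ≤ R := max_le (by simpa using m₁) (by simpa using m₂)
  obtain ⟨ζ₁, ht₁, he₁⟩ := exists_inward_perturbation hFd hK hz₁ (hne _ hz₁)
    (hFre _ hz₁) hr0 (le_max_left _ _)
  obtain ⟨ζ₂, ht₂, he₂⟩ := exists_inward_perturbation hFd hK hz₂ (hne _ hz₂)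
    (hFre _ hz₂) hr0 (le_max_right _ _)
  have hdist : ∀ᶠ δ in nhdsWithin (0 : ℝ) (Set.Ioi 0), ζ₁ δ ≠ ζ₂ δ :=
    (ht₁.prodMk_nhds ht₂).eventually ((isOpen_ne_fun continuous_fst continuous_snd).mem_nhds h12)
  obtain ⟨δ, ⟨g₁, n₁⟩, ⟨g₂, n₂⟩, hd, hδ⟩ :=
    (he₁.and (he₂.and (hdist.and self_mem_nhdsWithin))).exists
  have hδ : 0 < δ := hδ
  have hδ' : (1 + δ : ℂ) ≠ 0 := by
    exact_mod_cast (by linarith : (1 + δ : ℝ) ≠ 0)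
  -- `F + δ G` is `1 + δ` times the member of the family with parameter `s / (1 + δ)`.
  have hq : ∀ z, ((s / (1 + δ) : ℝ) : ℂ) * f z + (1 - ((s / (1 + δ) : ℝ) : ℂ)) * G z =
      (F z + δ * (z * K z)) / (1 + δ) := fun z => by
    simp only [hF, hG]
    push_cast
    field_simp
    ring
  have h3 := hmin (ζ₁ δ) (by simpa using n₁.le.trans hrR) (ζ₂ δ) (by simpa using n₂.le.trans hrR)
    (s / (1 + δ)) ⟨div_nonneg hs.1 (by linarith), by
      rw [div_le_one (by linarith)]; linarith [hs.2]⟩ hd (by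
      rw [hq, hq, g₁, g₂]
      exact congrArg (· / (1 + (δ : ℂ))) hFeq)
  exact absurd h3 (not_le.2 (max_lt n₁ n₂))

/-! ### From bounds on the derivative to bounds on the function -/

/-- If `|f| ≥ ρ` on the circle `|z| = r`, then `f` maps the disc `|z| < r` onto a set containing the
disc `|w| < ρ`, since the image is open and its boundary lies outside. So a univalent `f` takes no
value of that disc at points with `|z| ≥ r`. -/
lemma le_norm_of_le_norm_on_sphere {f : ℂ → ℂ} (hf : DifferentiableOn ℂ f (ball 0 1))
    (hf0 : f 0 = 0) (hinj : Set.InjOn f (ball 0 1)) {r ρ : ℝ} (hr0 : 0 < r) (hr1 : r < 1)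
    (hmin : ∀ z ∈ sphere (0 : ℂ) r, ρ ≤ ‖f z‖) {z : ℂ} (hz : z ∈ ball (0 : ℂ) 1)
    (hrz : r ≤ ‖z‖) : ρ ≤ ‖f z‖ := by
  by_contra! hlt
  have hsub : closedBall (0 : ℂ) r ⊆ ball 0 1 := closedBall_subset_ball hr1
  have hsub' : ball (0 : ℂ) r ⊆ ball 0 1 := ball_subset_closedBall.trans hsub
  have hρ : 0 < ρ := (norm_nonneg _).trans_lt hlt
  have hopen : IsOpen (f '' ball 0 r) := by
    rcases (hf.analyticOnNhd isOpen_ball).is_constant_or_isOpen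
      (convex_ball (0 : ℂ) 1).isPreconnected with ⟨w, hw⟩ | h
    · have h0 : (0 : ℂ) ∈ ball (0 : ℂ) 1 := mem_ball_self one_pos
      have h1 := hinj hz h0 ((hw z hz).trans (hw 0 h0).symm)
      rw [h1, norm_zero] at hrz
      linarith
    · exact h _ hsub' isOpen_ball
  have hcompact : IsCompact (f '' closedBall 0 r) :=
    (isCompact_closedBall _ _).image_of_continuousOn (hf.continuousOn.mono hsub)
  have hcl : closure (f '' ball 0 r) ⊆ f '' closedBall 0 r :=
    closure_minimal (Set.image_mono ball_subset_closedBall) hcompact.isClosed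
  have hcover : ball (0 : ℂ) ρ ⊆ f '' ball 0 r := by
    refine (convex_ball (0 : ℂ) ρ).isPreconnected.subset_of_closure_inter_subset hopen
      ⟨0, mem_ball_self hρ, 0, mem_ball_self hr0, hf0⟩ ?_
    rintro w ⟨hw, hwρ⟩
    obtain ⟨x, hx, rfl⟩ := hcl hw
    rw [mem_closedBall_zero_iff] at hx
    rcases hx.lt_or_eq with h | h
    · exact ⟨x, by simpa using h, rfl⟩
    · rw [mem_ball_zero_iff] at hwρ
      exact absurd (hmin x (by simpa using h)) (not_le.2 hwρ)
  obtain ⟨x, hx, hxz⟩ := hcover (by simpa using hlt : f z ∈ ball (0 : ℂ) ρ)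
  have := hinj (hsub' hx) hz hxz
  rw [this, mem_ball_zero_iff] at hx
  linarith

lemma hasDerivAt_integral_of_continuousOn {m : ℝ → ℝ} (hm : ContinuousOn m (Set.Ioo (-1) 1))
    {r : ℝ} (hr : r ∈ Set.Ico (0 : ℝ) 1) :
    HasDerivAt (fun r => ∫ t in (0 : ℝ)..r, m t) (m r) r := by
  have hIoo : ∀ r ∈ Set.Ico (0 : ℝ) 1, r ∈ Set.Ioo (-1 : ℝ) 1 := fun r hr =>
    ⟨by linarith [hr.1], hr.2⟩
  refine intervalIntegral.integral_hasDerivAt_right ?_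
    (hm.stronglyMeasurableAtFilter isOpen_Ioo r (hIoo r hr))
    (hm.continuousAt (isOpen_Ioo.mem_nhds (hIoo r hr)))
  refine (hm.mono fun t ht => ?_).intervalIntegrable
  rw [Set.uIcc_of_le hr.1] at ht
  exact hIoo t ⟨ht.1, ht.2.trans_lt hr.2⟩

/-- If `f` is univalent and `|f'(z)| ≥ m(|z|)`, then `|f(z)| ≥ ∫₀^|z| m`. Otherwise
`|f(z)| - c ∫₀^|z| m` would have a negative minimum over a closed disc for some `c < 1`; but it
decreases in the direction `-f/f'`. That this direction does not leave the disc is where univalence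
enters. -/
theorem integral_le_norm_of_injOn {f : ℂ → ℂ} (hf : DifferentiableOn ℂ f (ball 0 1))
    (hf0 : f 0 = 0) (hinj : Set.InjOn f (ball 0 1)) {m : ℝ → ℝ}
    (hm : ContinuousOn m (Set.Ioo (-1) 1)) (hmpos : ∀ t ∈ Set.Ico (0 : ℝ) 1, 0 < m t)
    (hfm : ∀ z ∈ ball (0 : ℂ) 1, m ‖z‖ ≤ ‖deriv f z‖) {z : ℂ} (hz : z ∈ ball (0 : ℂ) 1) :
    ∫ t in (0 : ℝ)..‖z‖, m t ≤ ‖f z‖ := by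
  set M : ℝ → ℝ := fun r => ∫ t in (0 : ℝ)..r, m t with hM
  have hMd : ∀ r ∈ Set.Ico (0 : ℝ) 1, HasDerivAt M (m r) r := fun r hr =>
    hasDerivAt_integral_of_continuousOn hm hr
  have hM0 : M 0 = 0 := by simp [hM]
  rw [mem_ball_zero_iff] at hz
  set R := ‖z‖ with hR
  have hsub : closedBall (0 : ℂ) R ⊆ ball 0 1 := closedBall_subset_ball hz
  suffices h : ∀ c ∈ Set.Ioo (0 : ℝ) 1, c * M R ≤ ‖f z‖ by
    have h1 : Filter.Tendsto (fun c : ℝ => c * M R) (nhdsWithin 1 (Set.Iio 1)) (nhds (1 * M R)) :=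
      ((continuous_id.mul continuous_const).tendsto 1).mono_left nhdsWithin_le_nhds
    rw [one_mul] at h1
    refine le_of_tendsto h1 ?_
    filter_upwards [Ioo_mem_nhdsLT (zero_lt_one' ℝ)] with c hc using h c hc
  intro c hc
  have hcont : ContinuousOn (fun x => ‖f x‖ - c * M ‖x‖) (closedBall 0 R) :=
    (hf.continuousOn.mono hsub).norm.sub (continuousOn_const.mul fun y hy =>
      ((hMd ‖y‖ ⟨norm_nonneg y, by simpa using hsub hy⟩).continuousAt.comp
        continuous_norm.continuousAt).continuousWithinAt)
  obtain ⟨x, hx, hmin⟩ := (isCompact_closedBall (0 : ℂ) R).exists_isMinOn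
    ⟨0, by simp [hR]⟩ hcont
  have hxz : ‖f x‖ - c * M ‖x‖ ≤ ‖f z‖ - c * M ‖z‖ := hmin (by simp [hR])
  suffices hx0 : x = 0 by
    rw [hx0, hf0, norm_zero, hM0] at hxz
    linarith
  by_contra hx0
  have hx1 := hsub hx
  have hxpos : 0 < ‖x‖ := norm_pos_iff.2 hx0
  have hfx : f x ≠ 0 := fun h =>
    hx0 (hinj hx1 (mem_ball_self one_pos) (h.trans hf0.symm))
  have hxI : ‖x‖ ∈ Set.Ico (0 : ℝ) 1 := ⟨norm_nonneg _, by simpa using hx1⟩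
  have hmx : 0 < m ‖x‖ := hmpos _ hxI
  have hf' : deriv f x ≠ 0 := norm_pos_iff.1 (hmx.trans_le (hfm x hx1))
  -- Along `x + δ v` the modulus of `f` decreases at rate `|f x|`, while `|v| ≤ |f x| / m(|x|)`
  -- limits the decrease of `M` to that rate.
  set v : ℂ := -(f x / deriv f x) with hv
  have hγ : HasDerivAt (fun δ : ℝ => x + (δ : ℂ) * v) v 0 := by
    have := (Complex.ofRealCLM.hasDerivAt (x := (0 : ℝ))).mul_const v
    simpa using this.const_add x
  have hγ0 : x + ((0 : ℝ) : ℂ) * v = x := by simp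
  have hfγ : HasDerivAt (fun δ : ℝ => f (x + (δ : ℂ) * v)) (deriv f x * v) 0 :=
    HasDerivAt.comp (h₂ := f) (h := fun δ : ℝ => x + (δ : ℂ) * v) 0
      (by rw [hγ0]; exact hasDerivAt_of_mem_unitBall hf hx1) hγ
  have hnf := hasDerivAt_norm_curve hfγ (by rw [hγ0]; exact hfx)
  have hnx := hasDerivAt_norm_curve hγ (by rw [hγ0]; exact hx0)
  rw [hγ0] at hnf hnx
  have e1 : ‖f x‖ * (deriv f x * v / f x).re = -‖f x‖ := by
    have : deriv f x * v / f x = -1 := by rw [hv]; field_simp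
    rw [this]; simp
  rw [e1] at hnf
  have hMγ : HasDerivAt (fun δ : ℝ => M ‖x + (δ : ℂ) * v‖) (m ‖x‖ * (‖x‖ * (v / x).re)) 0 :=
    HasDerivAt.comp (h₂ := M) (h := fun δ : ℝ => ‖x + (δ : ℂ) * v‖) 0
      (by rw [hγ0]; exact hMd _ hxI) hnx
  have hneg : -‖f x‖ - c * (m ‖x‖ * (‖x‖ * (v / x).re)) < 0 := by
    have h1 : -‖v‖ ≤ ‖x‖ * (v / x).re := by
      have h2 := (abs_le.1 (Complex.abs_re_le_norm (v / x))).1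
      rw [norm_div] at h2
      have h3 := mul_le_mul_of_nonneg_left h2 hxpos.le
      rwa [mul_neg, mul_div_cancel₀ _ hxpos.ne'] at h3
    have h2 : m ‖x‖ * ‖v‖ ≤ ‖f x‖ := by
      rw [hv, norm_neg, norm_div, ← mul_div_assoc, div_le_iff₀ (norm_pos_iff.2 hf'), mul_comm]
      exact mul_le_mul_of_nonneg_left (hfm x hx1) (norm_nonneg _)
    have h3 := mul_le_mul_of_nonneg_left h1 hmx.le
    have h4 : -‖f x‖ ≤ m ‖x‖ * (‖x‖ * (v / x).re) := by linarith
    have h5 := mul_le_mul_of_nonneg_left h4 hc.1.le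
    have h6 : 0 < ‖f x‖ := norm_pos_iff.2 hfx
    nlinarith [hc.2]
  have ev1 := eventually_lt_of_hasDerivAt_neg hnf (neg_lt_zero.2 (norm_pos_iff.2 hfx))
  have ev2 := eventually_lt_of_hasDerivAt_neg (hnf.sub (hMγ.const_mul c)) hneg
  have htend : Filter.Tendsto (fun δ : ℝ => x + (δ : ℂ) * v) (nhdsWithin 0 (Set.Ioi 0))
      (nhds x) := by
    have := hγ.continuousAt.tendsto
    rw [hγ0] at this
    exact this.mono_left nhdsWithin_le_nhds
  have hball := htend.eventually (isOpen_ball.mem_nhds hx1)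
  rcases (mem_closedBall_zero_iff.1 hx).lt_or_eq with hlt | heq
  · have hball' := htend.eventually (isOpen_ball.mem_nhds (mem_ball_zero_iff.2 hlt))
    obtain ⟨δ, h2, h3⟩ := (ev2.and hball').exists
    simp only [Pi.sub_apply, hγ0] at h2
    exact absurd (hmin (ball_subset_closedBall h3)) (not_le.2 h2)
  · obtain ⟨δ, h1, h2, h3⟩ := (ev1.and (ev2.and hball)).exists
    simp only [Pi.sub_apply, hγ0] at h1 h2
    by_cases hin : x + (δ : ℂ) * v ∈ closedBall (0 : ℂ) R
    · exact absurd (hmin hin) (not_le.2 h2)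
    -- `|f|` has its minimum over the circle `|y| = R` at `x`, so it cannot be smaller outside.
    · refine absurd (le_norm_of_le_norm_on_sphere hf hf0 hinj (heq ▸ hxpos) hz
        (ρ := ‖f x‖) ?_ h3 ?_)
        (not_le.2 h1)
      · intro y hy
        have h4 : ‖f x‖ - c * M ‖x‖ ≤ ‖f y‖ - c * M ‖y‖ := hmin (sphere_subset_closedBall hy)
        rw [mem_sphere_zero_iff_norm.1 hy, heq] at h4
        linarith
      · rw [mem_closedBall_zero_iff, not_le] at hin
        exact hin.le

theorem norm_le_integral_of_norm_deriv_le {f : ℂ → ℂ} (hf : DifferentiableOn ℂ f (ball 0 1))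
    (hf0 : f 0 = 0) {m : ℝ → ℝ} (hm : ContinuousOn m (Set.Ioo (-1) 1))
    (hfm : ∀ z ∈ ball (0 : ℂ) 1, ‖deriv f z‖ ≤ m ‖z‖) {z : ℂ} (hz : z ∈ ball (0 : ℂ) 1) :
    ‖f z‖ ≤ ∫ t in (0 : ℝ)..‖z‖, m t := by
  have hmem : ∀ t ∈ Set.Icc (0 : ℝ) 1, t * ‖z‖ ∈ Set.Ico (0 : ℝ) 1 := fun t ht => by
    rw [mem_ball_zero_iff] at hz
    exact ⟨mul_nonneg ht.1 (norm_nonneg z), by nlinarith [norm_nonneg z, ht.2]⟩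
  have hB : ∀ t ∈ Set.Icc (0 : ℝ) 1,
      HasDerivAt (fun t => ∫ s in (0 : ℝ)..t * ‖z‖, m s) (m (t * ‖z‖) * ‖z‖) t := fun t ht =>
    HasDerivAt.comp (h₂ := fun r => ∫ s in (0 : ℝ)..r, m s) (h := fun t => t * ‖z‖) t
      (hasDerivAt_integral_of_continuousOn hm (hmem t ht)) (hasDerivAt_mul_const ‖z‖)
  have hF : ∀ t ∈ Set.Icc (0 : ℝ) 1, HasDerivAt (fun s : ℝ => f ((s : ℂ) * z))
      (deriv f ((t : ℂ) * z) * z) t := fun t ht => hasDerivAt_radial hf (smul_mem_unitBall hz ht)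
  have := image_norm_le_of_norm_deriv_right_le_deriv_boundary'
    (fun t ht => (hF t ht).continuousAt.continuousWithinAt)
    (fun t ht => (hF t (Set.Ico_subset_Icc_self ht)).hasDerivWithinAt)
    (B := fun t => ∫ s in (0 : ℝ)..t * ‖z‖, m s) (by simp [hf0])
    (fun t ht => (hB t ht).continuousAt.continuousWithinAt)
    (fun t ht => (hB t (Set.Ico_subset_Icc_self ht)).hasDerivWithinAt)
    (fun t ht => by
      rw [norm_mul]
      refine mul_le_mul_of_nonneg_right ?_ (norm_nonneg z)
      have h := hfm _ (smul_mem_unitBall hz (Set.Ico_subset_Icc_self ht))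
      rwa [norm_mul, Complex.norm_real, Real.norm_of_nonneg ht.1] at h)
    (Set.right_mem_Icc.2 zero_le_one)
  simpa using this

/-! ### Bounds for the class `𝒦ₛ(φ)` -/

lemma Admissible.ne_zero {φ : ℂ → ℂ} (hφ : Admissible φ) {z : ℂ} (hz : z ∈ ball (0 : ℂ) 1) :
    φ z ≠ 0 := fun h => by
  have := hφ.re_pos z hz
  rw [h] at this
  simp at this

lemma ofReal_mem_unitBall {r : ℝ} (hr : r ∈ Set.Ioo (-1 : ℝ) 1) : (r : ℂ) ∈ ball (0 : ℂ) 1 := by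
  rw [mem_ball_zero_iff, Complex.norm_real, Real.norm_eq_abs]
  exact abs_lt.2 hr

lemma Admissible.ofReal_re {φ : ℂ → ℂ} (hφ : Admissible φ) {r : ℝ} (hr0 : 0 ≤ r) (hr1 : r < 1) :
    φ (r : ℂ) = ((φ (r : ℂ)).re : ℂ) := by
  obtain ⟨M, -, h⟩ := hφ.max_eq r hr0 hr1
  rw [h, Complex.ofReal_re]

lemma Admissible.ofReal_re_neg {φ : ℂ → ℂ} (hφ : Admissible φ) {r : ℝ} (hr0 : 0 ≤ r)
    (hr1 : r < 1) : φ (-(r : ℂ)) = ((φ (-(r : ℂ))).re : ℂ) := by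
  obtain ⟨M, -, h⟩ := hφ.min_eq r hr0 hr1
  rw [h, Complex.ofReal_re]

/-- The bounds on the circle `|w| = r` extend to the disc by the maximum principle for `φ` and
`1 / φ`. -/
lemma Admissible.norm_bounds {φ : ℂ → ℂ} (hφ : Admissible φ) {r : ℝ} (hr1 : r < 1) {w : ℂ}
    (hw : ‖w‖ ≤ r) : (φ (-(r : ℂ))).re ≤ ‖φ w‖ ∧ ‖φ w‖ ≤ (φ (r : ℂ)).re := by
  have hr0 : 0 ≤ r := (norm_nonneg w).trans hw
  rcases hr0.eq_or_lt with rfl | hpos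
  · have : w = 0 := norm_le_zero_iff.1 hw
    simp [this, hφ.map_zero]
  have hsub : closure (ball (0 : ℂ) r) ⊆ ball 0 1 :=
    closure_ball_subset_closedBall.trans (closedBall_subset_ball hr1)
  have hwc : w ∈ closure (ball (0 : ℂ) r) := by
    rw [closure_ball _ hpos.ne']; simpa using hw
  obtain ⟨m, ⟨⟨x, hx, hxm⟩, hm⟩, hm'⟩ := hφ.min_eq r hr0 hr1
  obtain ⟨M, ⟨-, hM⟩, hM'⟩ := hφ.max_eq r hr0 hr1
  rw [hm', hM', Complex.ofReal_re, Complex.ofReal_re]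
  have hd := hφ.differentiableOn.mono hsub
  constructor
  · have hm0 : 0 < m := by
      rw [← hxm]
      exact norm_pos_iff.2 (hφ.ne_zero (sphere_subset_ball hr1 hx))
    have h1 : ‖(φ w)⁻¹‖ ≤ m⁻¹ := by
      refine Complex.norm_le_of_forall_mem_frontier_norm_le (f := fun z => (φ z)⁻¹) isBounded_ball
        (hd.inv fun z hz => hφ.ne_zero (hsub hz)).diffContOnCl ?_ hwc
      intro z hz
      rw [frontier_ball _ hpos.ne'] at hz
      rw [norm_inv]
      exact inv_anti₀ hm0 (hm ⟨z, hz, rfl⟩)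
    rw [norm_inv] at h1
    exact (inv_le_inv₀ (norm_pos_iff.2 (hφ.ne_zero (hsub hwc))) hm0).1 h1
  · refine Complex.norm_le_of_forall_mem_frontier_norm_le isBounded_ball hd.diffContOnCl ?_ hwc
    intro z hz
    rw [frontier_ball _ hpos.ne'] at hz
    exact hM ⟨z, hz, rfl⟩

/-- The membership of `f` in `𝒦ₛ(φ)`, with the quotient resolved for `f'`. -/
lemma exists_deriv_eq_of_mem_classKs {φ f : ℂ → ℂ} (hφ : Admissible φ) (hf : f ∈ ClassKs φ) :
    ∃ g, StarlikeOfOrder (1 / 2) g ∧ ∃ w : ℂ → ℂ, ∀ z ∈ ball (0 : ℂ) 1,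
      ‖w z‖ ≤ ‖z‖ ∧ deriv f z = φ (w z) * symmProduct g z := by
  obtain ⟨hfn, g, hg, w, hwd, hw0, hw1, hw⟩ := hf
  refine ⟨g, hg, w, fun z hz => ⟨?_, ?_⟩⟩
  · exact Complex.norm_le_norm_of_mapsTo_ball hwd
      (fun x hx => by simpa using (hw1 x hx).le) hw0 (by simpa using hz)
  · rcases eq_or_ne z 0 with rfl | hz0
    · rw [hw0, hφ.map_zero, hg.normalized.symmProduct_zero, hfn.deriv_zero, one_mul]
    · have h1 := hw z hz
      have h2 := hg.normalized.sq_mul_symmProduct z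
      have h3 := hg.symmProduct_ne_zero hz
      have h4 : g z * g (-z) = -(z ^ 2 * symmProduct g z) := by rw [h2, neg_neg]
      rw [quotientFun, if_neg hz0, h4] at h1
      rw [← h1]
      field_simp

/-- Writing `f' = φ(w) · G(z) / z` with `|w| ≤ |z|` and `G` odd and starlike, each factor is bounded
separately. -/
lemma norm_deriv_bounds_of_mem_classKs {φ f : ℂ → ℂ} (hφ : Admissible φ) (hf : f ∈ ClassKs φ)
    {z : ℂ} (hz : z ∈ ball (0 : ℂ) 1) :
    (φ (-(‖z‖ : ℂ))).re / (1 + ‖z‖ ^ 2) ≤ ‖deriv f z‖ ∧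
      ‖deriv f z‖ ≤ (φ (‖z‖ : ℂ)).re / (1 - ‖z‖ ^ 2) := by
  obtain ⟨g, hg, w, hw⟩ := exists_deriv_eq_of_mem_classKs hφ hf
  obtain ⟨hwz, hd⟩ := hw z hz
  obtain ⟨k1, k2⟩ := hg.norm_symmProduct_bounds hz
  rw [mem_ball_zero_iff] at hz
  obtain ⟨p1, p2⟩ := hφ.norm_bounds hz hwz
  have hpos : 0 < 1 - ‖z‖ ^ 2 := by nlinarith [norm_nonneg z]
  rw [hd, norm_mul]
  constructor
  · rw [div_le_iff₀ (by positivity), mul_assoc]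
    exact p1.trans (le_mul_of_one_le_right (norm_nonneg _) k2)
  · rw [le_div_iff₀ hpos, mul_assoc]
    exact (mul_le_of_le_one_right (norm_nonneg _) k1).trans p2

lemma injOn_of_mem_classKs {φ f : ℂ → ℂ} (hφ : Admissible φ) (hf : f ∈ ClassKs φ) :
    Set.InjOn f (ball 0 1) := by
  obtain ⟨g, hg, w, hw⟩ := exists_deriv_eq_of_mem_classKs hφ hf
  refine injOn_of_re_deriv_div_pos hf.1.differentiableOn hg.normalized.differentiableOn_symmProduct
    (fun z hz => hg.symmProduct_ne_zero hz) (fun z hz => ?_) (fun z hz => hg.re_symmProduct_pos hz)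
  rw [(hw z hz).2, mul_div_cancel_right₀ _ (hg.symmProduct_ne_zero hz)]
  refine hφ.re_pos _ ?_
  rw [mem_ball_zero_iff] at hz ⊢
  exact (hw z (by simpa using hz)).1.trans_lt hz

lemma Admissible.continuousOn_lower {φ : ℂ → ℂ} (hφ : Admissible φ) :
    ContinuousOn (fun t : ℝ => (φ (-(t : ℂ))).re / (1 + t ^ 2)) (Set.Ioo (-1) 1) := by
  refine ContinuousOn.div ?_ (by fun_prop) fun t _ => by positivity
  refine Complex.continuous_re.comp_continuousOn (hφ.differentiableOn.continuousOn.comp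
    (by fun_prop) fun t ht => neg_mem_unitBall (ofReal_mem_unitBall ht))

lemma Admissible.continuousOn_upper {φ : ℂ → ℂ} (hφ : Admissible φ) :
    ContinuousOn (fun t : ℝ => (φ (t : ℂ)).re / (1 - t ^ 2)) (Set.Ioo (-1) 1) := by
  refine ContinuousOn.div ?_ (by fun_prop) fun t ht => by nlinarith [ht.1, ht.2]
  refine Complex.continuous_re.comp_continuousOn (hφ.differentiableOn.continuousOn.comp
    (by fun_prop) fun t ht => ofReal_mem_unitBall ht)

/-! ### Extremal functions -/

/-- The functions `z / (1 - c z)` with `|c| = 1` map the disc onto half-planes. -/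
lemma starlikeOfOrder_half_div {c : ℂ} (hc : ‖c‖ = 1) :
    StarlikeOfOrder (1 / 2) fun z => z / (1 - c * z) := by
  have hlt : ∀ z ∈ ball (0 : ℂ) 1, ‖c * z‖ < 1 := fun z hz => by
    rw [norm_mul, hc, one_mul]; simpa using hz
  have hne : ∀ z ∈ ball (0 : ℂ) 1, 1 - c * z ≠ 0 := fun z hz h => by
    have := hlt z hz
    rw [← sub_eq_zero.1 h, norm_one] at this
    exact lt_irrefl _ this
  have hd : ∀ z ∈ ball (0 : ℂ) 1,
      HasDerivAt (fun z => z / (1 - c * z)) (1 / (1 - c * z) ^ 2) z := fun z hz => by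
    have h1 : HasDerivAt (fun z => 1 - c * z) (-c) z := by
      simpa using ((hasDerivAt_id z).const_mul c).const_sub 1
    refine ((hasDerivAt_id z).div h1 (hne z hz)).congr_deriv ?_
    simp only [id]
    congr 1
    ring
  refine ⟨⟨fun z hz => (hd z hz).differentiableAt.differentiableWithinAt, by simp, ?_⟩, ?_⟩
  · rw [(hd 0 (mem_ball_self one_pos)).deriv]; simp
  · intro z hz hz0
    have h1 := hne z hz
    have e : z * deriv (fun z => z / (1 - c * z)) z / (z / (1 - c * z)) = (1 - c * z)⁻¹ := by
      rw [(hd z hz).deriv]; field_simp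
    have h2 := hlt z hz
    have h3 : 0 < Complex.normSq (1 - c * z) := Complex.normSq_pos.2 h1
    have h4 : Complex.normSq (c * z) < 1 := by
      rw [Complex.normSq_eq_norm_sq]; nlinarith [norm_nonneg (c * z)]
    change 1 / 2 < (z * deriv (fun z => z / (1 - c * z)) z / (z / (1 - c * z))).re
    rw [e, Complex.inv_re, lt_div_iff₀ h3]
    generalize c * z = u at *
    rw [Complex.normSq_apply] at h4 ⊢
    simp only [Complex.sub_re, Complex.sub_im, Complex.one_re, Complex.one_im]
    nlinarith

lemma hasDerivAt_integralFromZero {h : ℂ → ℂ} (hh : DifferentiableOn ℂ h (ball 0 1)) {z : ℂ}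
    (hz : z ∈ ball (0 : ℂ) 1) : HasDerivAt (integralFromZero h) (h z) z := by
  obtain ⟨F, hF⟩ := hh.isExactOn_ball
  have hFd : DifferentiableOn ℂ F (ball 0 1) := fun x hx =>
    (hF x hx).differentiableAt.differentiableWithinAt
  have key : ∀ x ∈ ball (0 : ℂ) 1, integralFromZero h x = F x - F 0 := fun x hx => by
    have hmem : ∀ t ∈ Set.uIcc (0 : ℝ) 1, (t : ℂ) * x ∈ ball (0 : ℂ) 1 := fun t ht =>
      smul_mem_unitBall hx (by rwa [Set.uIcc_of_le zero_le_one] at ht)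
    have h1 := intervalIntegral.integral_eq_sub_of_hasDerivAt (a := (0 : ℝ)) (b := 1)
      (f := fun t : ℝ => F ((t : ℂ) * x)) (f' := fun t : ℝ => h ((t : ℂ) * x) * x)
      (fun t ht => by
        have := hasDerivAt_radial hFd (hmem t ht)
        rwa [(hF _ (hmem t ht)).deriv] at this)
      (ContinuousOn.intervalIntegrable
        ((hh.continuousOn.comp (by fun_prop) hmem).mul continuousOn_const))
    rw [integralFromZero, h1]
    simp
  refine ((hF z hz).sub_const (F 0)).congr_of_eventuallyEq ?_
  filter_upwards [isOpen_ball.mem_nhds hz] with x hx using key x hx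

/-- The radial integral of a function that is real and nonnegative along the ray in
direction `ε`. -/
lemma norm_integralFromZero_of_real {h : ℂ → ℂ} {m : ℝ → ℝ} {ε : ℂ} (hε : ‖ε‖ = 1) {r : ℝ}
    (hr : 0 ≤ r) (hm : ∀ t ∈ Set.Icc (0 : ℝ) r, h (ε * t) = m t ∧ 0 ≤ m t) :
    ‖integralFromZero h (ε * r)‖ = ∫ t in (0 : ℝ)..r, m t := by
  have h1 : integralFromZero h (ε * r) = ε * ((∫ t in (0 : ℝ)..r, m t : ℝ) : ℂ) := by
    have h2 := intervalIntegral.smul_integral_comp_mul_right (a := 0) (b := 1) m r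
    rw [zero_mul, one_mul, smul_eq_mul] at h2
    rw [← h2, Complex.ofReal_mul, ← intervalIntegral.integral_ofReal, ← mul_assoc,
      ← intervalIntegral.integral_const_mul, integralFromZero]
    refine intervalIntegral.integral_congr fun t ht => ?_
    rw [Set.uIcc_of_le zero_le_one] at ht
    have h3 := (hm (t * r) ⟨mul_nonneg ht.1 hr, mul_le_of_le_one_left hr ht.2⟩).1
    have h4 : (t : ℂ) * (ε * r) = ε * ((t * r : ℝ) : ℂ) := by push_cast; ring
    simp only [h4, h3]
    ring
  rw [h1, norm_mul, hε, one_mul, Complex.norm_real, Real.norm_of_nonneg]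
  exact intervalIntegral.integral_nonneg hr fun t ht => (hm t ht).2

lemma differentiableOn_extremal {φ : ℂ → ℂ} (hφ : Admissible φ) {c : ℂ} (hc : ‖c‖ = 1) :
    DifferentiableOn ℂ (fun w => φ w / (1 - c ^ 2 * w ^ 2)) (ball 0 1) := by
  refine hφ.differentiableOn.div (by fun_prop) fun z hz h => ?_
  rw [mem_ball_zero_iff] at hz
  have h1 : ‖c ^ 2 * z ^ 2‖ = 1 := by rw [← sub_eq_zero.1 h, norm_one]
  rw [norm_mul, norm_pow, norm_pow, hc] at h1
  nlinarith [norm_nonneg z]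

/-- With `g(z) = z / (1 - c z)` one has `-g(z) g(-z) / z² = 1 / (1 - c² z²)`, so the function
`f` with `f'(z) = φ(z) / (1 - c² z²)` belongs to `𝒦ₛ(φ)`. -/
lemma integralFromZero_mem_classKs {φ : ℂ → ℂ} (hφ : Admissible φ) {c : ℂ} (hc : ‖c‖ = 1) :
    integralFromZero (fun w => φ w / (1 - c ^ 2 * w ^ 2)) ∈ ClassKs φ := by
  have hd := fun z (hz : z ∈ ball (0 : ℂ) 1) =>
    hasDerivAt_integralFromZero (differentiableOn_extremal hφ hc) hz
  refine ⟨⟨fun z hz => (hd z hz).differentiableAt.differentiableWithinAt, ?_, ?_⟩,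
    fun z => z / (1 - c * z), starlikeOfOrder_half_div hc, id, differentiableOn_id, rfl,
    fun z hz => by simpa using hz, fun z hz => ?_⟩
  · simp [integralFromZero]
  · rw [(hd 0 (mem_ball_self one_pos)).deriv]; simp [hφ.map_zero]
  · rw [quotientFun, id]
    split_ifs with hz0
    · rw [hz0, hφ.map_zero]
    · have hn : ∀ z ∈ ball (0 : ℂ) 1, 1 - c * z ≠ 0 := fun z hz h => by
        rw [mem_ball_zero_iff] at hz
        have h1 : ‖c * z‖ = 1 := by rw [← sub_eq_zero.1 h, norm_one]
        rw [norm_mul, hc, one_mul] at h1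
        linarith
      have h1 := hn z hz
      have h2 := hn (-z) (neg_mem_unitBall hz)
      have h3 : 1 - c ^ 2 * z ^ 2 = (1 - c * z) * (1 - c * -z) := by ring
      rw [(hd z hz).deriv, h3]
      generalize 1 - c * z = A at *
      generalize 1 - c * -z = B at *
      field_simp

end CloseToConvex

open CloseToConvex

theorem mainTheorem2 (φ : ℂ → ℂ) (hφ : CloseToConvex.Admissible φ) :
    (∀ f ∈ CloseToConvex.ClassKs φ, ∀ (z : ℂ) (r : ℝ), ‖z‖ = r → r < 1 →
      ((φ (-(r : ℂ))).re / (1 + r ^ 2) ≤ ‖deriv f z‖ ∧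
        ‖deriv f z‖ ≤ (φ (r : ℂ)).re / (1 - r ^ 2)) ∧
      ((∫ t in (0 : ℝ)..r, (φ (-(t : ℂ))).re / (1 + t ^ 2)) ≤ ‖f z‖ ∧
        ‖f z‖ ≤ ∫ t in (0 : ℝ)..r, (φ (t : ℂ)).re / (1 - t ^ 2))) ∧
    (CloseToConvex.extremalUpper φ ∈ CloseToConvex.ClassKs φ ∧
      ∀ r : ℝ, 0 ≤ r → r < 1 →
        ‖deriv (CloseToConvex.extremalUpper φ) (r : ℂ)‖ = (φ (r : ℂ)).re / (1 - r ^ 2) ∧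
        ‖CloseToConvex.extremalUpper φ (r : ℂ)‖ =
          ∫ t in (0 : ℝ)..r, (φ (t : ℂ)).re / (1 - t ^ 2)) ∧
    (CloseToConvex.extremalLower φ ∈ CloseToConvex.ClassKs φ ∧
      ∀ r : ℝ, 0 ≤ r → r < 1 →
        ‖deriv (CloseToConvex.extremalLower φ) (-(r : ℂ))‖ =
          (φ (-(r : ℂ))).re / (1 + r ^ 2) ∧
        ‖CloseToConvex.extremalLower φ (-(r : ℂ))‖ =
          ∫ t in (0 : ℝ)..r, (φ (-(t : ℂ))).re / (1 + t ^ 2)) := by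
  have hball : ∀ t : ℝ, 0 ≤ t → t < 1 → (t : ℂ) ∈ ball (0 : ℂ) 1 := fun t h0 h1 =>
    ofReal_mem_unitBall ⟨by linarith, h1⟩
  refine ⟨?_, ⟨?_, ?_⟩, ?_, ?_⟩
  · rintro f hf z r rfl hr
    have hz : z ∈ ball (0 : ℂ) 1 := by simpa using hr
    exact ⟨norm_deriv_bounds_of_mem_classKs hφ hf hz,
      integral_le_norm_of_injOn hf.1.differentiableOn hf.1.map_zero (injOn_of_mem_classKs hφ hf)
        hφ.continuousOn_lower
        (fun t ht => div_pos (hφ.re_pos _ (neg_mem_unitBall (hball t ht.1 ht.2))) (by positivity))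
        (fun x hx => (norm_deriv_bounds_of_mem_classKs hφ hf hx).1) hz,
      norm_le_integral_of_norm_deriv_le hf.1.differentiableOn hf.1.map_zero hφ.continuousOn_upper
        (fun x hx => (norm_deriv_bounds_of_mem_classKs hφ hf hx).2) hz⟩
  · simpa [extremalUpper] using integralFromZero_mem_classKs hφ (c := 1) (by simp)
  · intro r hr0 hr1
    have hm : ∀ t : ℝ, 0 ≤ t → t < 1 →
        φ t / (1 - (t : ℂ) ^ 2) = (((φ t).re / (1 - t ^ 2) : ℝ) : ℂ) ∧
          0 ≤ (φ t).re / (1 - t ^ 2) := fun t h0 h1 => by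
      refine ⟨?_, div_nonneg (hφ.re_pos _ (hball t h0 h1)).le (by nlinarith)⟩
      push_cast
      rw [← hφ.ofReal_re h0 h1]
    constructor
    · have hd := hasDerivAt_integralFromZero (differentiableOn_extremal hφ (c := 1) (by simp))
        (hball r hr0 hr1)
      simp only [one_pow, one_mul] at hd
      rw [extremalUpper, hd.deriv, (hm r hr0 hr1).1, Complex.norm_real,
        Real.norm_of_nonneg (hm r hr0 hr1).2]
    · have := norm_integralFromZero_of_real (h := fun w => φ w / (1 - w ^ 2))
        (m := fun t => (φ t).re / (1 - t ^ 2)) (ε := 1) (by simp) hr0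
        (fun t ht => by simpa using hm t ht.1 (ht.2.trans_lt hr1))
      rwa [one_mul] at this
  · simpa [extremalLower] using integralFromZero_mem_classKs hφ (c := Complex.I) (by simp)
  · intro r hr0 hr1
    have hm : ∀ t : ℝ, 0 ≤ t → t < 1 →
        φ (-t) / (1 + (-t : ℂ) ^ 2) = (((φ (-t)).re / (1 + t ^ 2) : ℝ) : ℂ) ∧
          0 ≤ (φ (-t)).re / (1 + t ^ 2) := fun t h0 h1 => by
      refine ⟨?_, div_nonneg (hφ.re_pos _ (neg_mem_unitBall (hball t h0 h1))).le (by positivity)⟩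
      push_cast
      rw [← hφ.ofReal_re_neg h0 h1, neg_sq]
    constructor
    · have hd := hasDerivAt_integralFromZero
        (differentiableOn_extremal hφ (c := Complex.I) (by simp))
        (neg_mem_unitBall (hball r hr0 hr1))
      simp only [Complex.I_sq, neg_one_mul, sub_neg_eq_add] at hd
      rw [extremalLower, hd.deriv, (hm r hr0 hr1).1, Complex.norm_real,
        Real.norm_of_nonneg (hm r hr0 hr1).2]
    · have := norm_integralFromZero_of_real (h := fun w => φ w / (1 + w ^ 2))
        (m := fun t => (φ (-t)).re / (1 + t ^ 2)) (ε := -1) (by simp) hr0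
        (fun t ht => by
          simp only [neg_one_mul]
          exact hm t ht.1 (ht.2.trans_lt hr1))
      rwa [neg_one_mul] at this
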